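/- Let $K$ be a field (for example $K=\mathbb{C}$) and let $n > 2$ be an integer. The generic determinant $\det_n = \det\big((x_{i,j})_{i,j=1}^n\big) \in K[x_{i,j} : 1 \le i,j \le n]$ is a form of degree $n$ in $n^2$ variables, and it is not a direct sum. Here a homogeneous polynomial $F$ of degree $d$ in $N$ variables is called a direct sum if there are linearly independent linear forms $t_1,\dots,t_N$ in these variables, an integer $0 \le s \le N$, and nonzero forms $F_1$, $F_2$ of degree $d$ with $F = F_1 + F_2$, $F_1 \in K[t_1,\dots,t_s]$ and $F_2 \in K[t_{s+1},\dots,t_N]$. -/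

import Mathlib

/-- A homogeneous polynomial `F` in the finitely many variables `σ` is a *direct sum* if
`F = F₁ + F₂` with `F₁`, `F₂` nonzero forms of the same degree as `F`, where, for some linearly
independent linear forms `t i` (one for each variable, hence a linear change of coordinates),
`F₁` is a polynomial in the `t i` with `i ∈ s` and `F₂` is a polynomial in the remaining ones.
With `V₁ = span (t '' s)` and `V₂ = span (t '' sᶜ)`, this says that `V₁ ⊕ V₂ = V` is the space of
linear forms and `Fᵢ ∈ S^d Vᵢ`. -/
def IsDirectSumForm {K σ : Type*} [Field K] [Finite σ] (F : MvPolynomial σ K) : Prop :=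
  ∃ (d : ℕ) (t : σ → MvPolynomial σ K) (s : Set σ) (F₁ F₂ : MvPolynomial σ K),
    F.IsHomogeneous d ∧
    (∀ i, (t i).IsHomogeneous 1) ∧ LinearIndependent K t ∧
    F₁ ≠ 0 ∧ F₁.IsHomogeneous d ∧ F₁ ∈ Algebra.adjoin K (t '' s) ∧
    F₂ ≠ 0 ∧ F₂.IsHomogeneous d ∧ F₂ ∈ Algebra.adjoin K (t '' sᶜ) ∧
    F = F₁ + F₂

/-- The generic `n × n` determinant `det (x_{i,j})`, a polynomial in the `n²` variables `x_{i,j}`. -/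
noncomputable def genericDet (K : Type*) [Field K] (n : ℕ) : MvPolynomial (Fin n × Fin n) K :=
  (Matrix.of fun i j : Fin n => (MvPolynomial.X (i, j) : MvPolynomial (Fin n × Fin n) K)).det

/-! If `F = F₁ + F₂` in separate coordinates, derivatives in one direction from each side kill `F`.
So the projection `P` of the space of directions onto one side is self-adjoint for every coefficient
matrix `H` of the second derivatives: `Pᵀ H = H P`. In positive degree both sides are nonzero, hence
`P` is not scalar (`exists_nonscalar_selfAdjoint_of_isDirectSumForm`).

For the determinant, a monomial of the minor complementary to a 2 × 2 minor gives an `H` that pairs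
only opposite corners of that minor. When `n > 2` there are enough such `H` to make `P` scalar
(`eq_scalar_of_selfAdjoint_hessianCoeff_genericDet`). The bound is sharp: `x₁₁x₂₂ - x₁₂x₂₁` is a
direct sum. -/

open MvPolynomial

/-! ### Direct sums and self-adjoint operators -/

namespace MvPolynomial

variable {K σ : Type*} [Field K]

/-- A linear form is the linear combination of the variables given by its coefficients. -/
theorem IsHomogeneous.eq_linearCombination_X [Fintype σ] {f : MvPolynomial σ K}
    (hf : f.IsHomogeneous 1) :
    f = Fintype.linearCombination K (X : σ → MvPolynomial σ K)
      fun x => f.coeff (Finsupp.single x 1) := by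
  classical
  ext m
  by_cases hm : m.degree = 1
  · obtain ⟨y, rfl⟩ := Finsupp.range_single_one.symm.subset hm
    simp [Fintype.linearCombination_apply, coeff_sum, coeff_X, Finsupp.single_left_inj]
  · rw [hf.coeff_eq_zero hm, Fintype.linearCombination_apply, coeff_sum]
    refine (Finset.sum_eq_zero fun x _ => ?_).symm
    rw [coeff_smul, coeff_X, if_neg (fun h => hm (by simp [← h])), smul_zero]

/-- The coefficients of linearly independent linear forms, one per variable, form an invertible
matrix. -/
theorem isUnit_coeff_of_linearIndependent [Fintype σ] [DecidableEq σ] {t : σ → MvPolynomial σ K}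
    (ht : ∀ i, (t i).IsHomogeneous 1) (hli : LinearIndependent K t) :
    IsUnit (Matrix.of fun i x => (t i).coeff (Finsupp.single x 1)) := by
  rw [← Matrix.linearIndependent_rows_iff_isUnit]
  refine LinearIndependent.of_comp (Fintype.linearCombination K (X : σ → MvPolynomial σ K)) ?_
  convert hli using 1
  funext i
  exact (ht i).eq_linearCombination_X.symm

/-- The derivative in the direction of a vector with constant coordinates. -/
noncomputable def directionalDeriv (v : σ → K) :
    Derivation K (MvPolynomial σ K) (MvPolynomial σ K) :=
  mkDerivation K fun x => C (v x)

theorem directionalDeriv_eq_sum [Fintype σ] (v : σ → K) (f : MvPolynomial σ K) :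
    directionalDeriv v f = ∑ x, v x • pderiv x f := by
  classical
  have hsum (g : MvPolynomial σ K) :
      (∑ x, v x • pderiv (R := K) x) g = ∑ x, v x • pderiv x g := by
    rw [← Derivation.coeFnAddMonoidHom_apply, map_sum, Finset.sum_apply]
    rfl
  have h : directionalDeriv v = ∑ x, v x • pderiv (R := K) x := by
    refine derivation_ext fun y => ?_
    rw [hsum]
    simp [directionalDeriv, mkDerivation_X, pderiv_X, Pi.single_apply, smul_eq_C_mul]
  rw [h, hsum]

/-- The commutator is a derivation, and it kills the variables because their derivatives are
constants. -/
theorem directionalDeriv_comm (v w : σ → K) (f : MvPolynomial σ K) :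
    directionalDeriv v (directionalDeriv w f) = directionalDeriv w (directionalDeriv v f) := by
  have h : ⁅directionalDeriv v, directionalDeriv w⁆ = 0 := by
    refine derivation_ext fun x => ?_
    simp [Derivation.commutator_apply, directionalDeriv, mkDerivation_X]
  rw [← sub_eq_zero, ← Derivation.commutator_apply, h, Derivation.coe_zero, Pi.zero_apply]

/-- The matrix of coefficients at the monomial `m` of the second partial derivatives of `f`. -/
noncomputable def hessianCoeff (f : MvPolynomial σ K) (m : σ →₀ ℕ) : Matrix σ σ K :=
  Matrix.of fun p q => (pderiv p (pderiv q f)).coeff m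

theorem coeff_directionalDeriv_directionalDeriv [Fintype σ] (v w : σ → K) (f : MvPolynomial σ K)
    (m : σ →₀ ℕ) :
    (directionalDeriv v (directionalDeriv w f)).coeff m =
      ∑ p, ∑ q, v p * hessianCoeff f m p q * w q := by
  simp only [directionalDeriv_eq_sum, map_sum, coeff_sum, Derivation.map_smul, coeff_smul,
    smul_eq_mul, Finset.mul_sum, hessianCoeff, Matrix.of_apply]
  rw [Finset.sum_comm]
  exact Finset.sum_congr rfl fun p _ => Finset.sum_congr rfl fun q _ => by ring

theorem derivation_eq_zero_of_mem_adjoin {A : Type*} [CommRing A] [Algebra K A]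
    (D : Derivation K A A) {s : Set A} (hs : ∀ a ∈ s, D a = 0) {a : A}
    (ha : a ∈ Algebra.adjoin K s) : D a = 0 :=
  Derivation.eqOn_adjoin (D2 := 0) hs ha

/-- Rules out `s = ∅` and `sᶜ = ∅`, which the definition of a direct sum does not exclude by itself.
-/
theorem IsHomogeneous.degree_eq_zero_of_mem_adjoin_empty {f : MvPolynomial σ K} {d : ℕ}
    (hf : f.IsHomogeneous d) (h0 : f ≠ 0) (h : f ∈ Algebra.adjoin K (∅ : Set (MvPolynomial σ K))) :
    d = 0 := by
  rw [Algebra.adjoin_empty, Algebra.mem_bot] at h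
  obtain ⟨c, rfl⟩ := h
  exact hf.inj_right (isHomogeneous_C σ c) h0

/-- The second derivatives of a direct sum admit a common self-adjoint operator that is not
scalar, namely the projection onto one of the summands. -/
theorem exists_nonscalar_selfAdjoint_of_isDirectSumForm [Fintype σ] [DecidableEq σ]
    {f : MvPolynomial σ K} {n : ℕ} (hn : n ≠ 0) (hf : f.IsHomogeneous n) (h0 : f ≠ 0)
    (h : IsDirectSumForm f) :
    ∃ P : Matrix σ σ K, (∀ c : K, P ≠ Matrix.scalar σ c) ∧
      ∀ m, P.transpose * hessianCoeff f m = hessianCoeff f m * P := by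
  classical
  obtain ⟨d, t, s, F₁, F₂, hd, ht, hli, h₁0, h₁d, h₁, h₂0, h₂d, h₂, rfl⟩ := h
  obtain rfl : d = n := hd.inj_right hf h0
  obtain ⟨T, hT⟩ := isUnit_coeff_of_linearIndependent ht hli
  -- The columns of `S` are the directions dual to the forms `t i`.
  set S : Matrix σ σ K := (↑T⁻¹ : Matrix σ σ K) with hS
  have hTS : (T : Matrix σ σ K) * S = 1 := T.mul_inv
  have hST : S * (T : Matrix σ σ K) = 1 := T.inv_mul
  let E : Matrix σ σ K := Matrix.diagonal fun i => if i ∈ s then 1 else 0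
  have hDt (y i : σ) : directionalDeriv (fun x => S x y) (t i) = C ((1 : Matrix σ σ K) i y) := by
    rw [(ht i).eq_linearCombination_X, Fintype.linearCombination_apply, map_sum, ← hTS,
      Matrix.mul_apply, map_sum, hT]
    refine Finset.sum_congr rfl fun x _ => ?_
    rw [Derivation.map_smul, directionalDeriv, mkDerivation_X, Matrix.of_apply, smul_eq_C_mul,
      C_mul]
  have hD₁ (y : σ) (hy : y ∉ s) : directionalDeriv (fun x => S x y) F₁ = 0 := by
    refine derivation_eq_zero_of_mem_adjoin _ ?_ h₁
    rintro _ ⟨i, hi, rfl⟩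
    rw [hDt, Matrix.one_apply_ne (by rintro rfl; exact hy hi), C_0]
  have hD₂ (y : σ) (hy : y ∈ s) : directionalDeriv (fun x => S x y) F₂ = 0 := by
    refine derivation_eq_zero_of_mem_adjoin _ ?_ h₂
    rintro _ ⟨i, hi, rfl⟩
    rw [hDt, Matrix.one_apply_ne (by rintro rfl; exact hi hy), C_0]
  have hDD (y z : σ) (hyz : ¬(y ∈ s ↔ z ∈ s)) :
      directionalDeriv (fun x => S x y) (directionalDeriv (fun x => S x z) (F₁ + F₂)) = 0 := by
    by_cases hy : y ∈ s
    · have hz : z ∉ s := by tauto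
      rw [map_add, hD₁ z hz, zero_add, directionalDeriv_comm, hD₂ y hy, map_zero]
    · have hz : z ∈ s := by tauto
      rw [map_add, hD₂ z hz, add_zero, directionalDeriv_comm, hD₁ y hy, map_zero]
  -- `E` is the projection in the coordinates `t`; conjugation carries it to the original ones.
  refine ⟨S * E * T, fun c hc => ?_, fun m => ?_⟩
  · have hE : E = Matrix.scalar σ c := by
      have : (T : Matrix σ σ K) * (S * E * T) * S = E := by
        rw [← Matrix.mul_assoc, ← Matrix.mul_assoc, hTS, Matrix.one_mul, Matrix.mul_assoc, hTS,
          Matrix.mul_one]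
      rw [← this, hc, Matrix.mul_assoc, Matrix.scalar_comm c (Commute.all c) S,
        ← Matrix.mul_assoc, hTS, Matrix.one_mul]
    have hEc (i : σ) : (if i ∈ s then (1 : K) else 0) = c := by
      simpa [E] using congrFun (congrFun hE i) i
    rcases s.eq_empty_or_nonempty with rfl | ⟨i, hi⟩
    · exact hn (h₁d.degree_eq_zero_of_mem_adjoin_empty h₁0 (by simpa using h₁))
    rcases sᶜ.eq_empty_or_nonempty with hs | ⟨j, hj⟩
    · exact hn (h₂d.degree_eq_zero_of_mem_adjoin_empty h₂0 (by simpa [hs] using h₂))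
    · have h1 := hEc i
      have h2 := hEc j
      rw [if_pos hi] at h1
      rw [if_neg hj] at h2
      exact one_ne_zero (h1.trans h2.symm)
  · set H := hessianCoeff (F₁ + F₂) m
    -- `Sᵀ H S` is `H` in the dual basis; by `hDD` it is block diagonal for `s` and `sᶜ`.
    have hG : E * (S.transpose * H * S) = (S.transpose * H * S) * E := by
      ext y z
      have hyz : (¬(y ∈ s ↔ z ∈ s)) → (S.transpose * H * S) y z = 0 := fun hyz => by
        have := congrArg (coeff m) (hDD y z hyz)
        rw [coeff_directionalDeriv_directionalDeriv, coeff_zero] at this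
        rw [← this, Matrix.mul_apply]
        simp only [Matrix.mul_apply, Matrix.transpose_apply, Finset.sum_mul]
        exact Finset.sum_comm
      rw [Matrix.diagonal_mul, Matrix.mul_diagonal]
      by_cases hy : y ∈ s <;> by_cases hz : z ∈ s <;> simp [hy, hz] at hyz ⊢ <;> simp [hyz]
    have hTS' : (T : Matrix σ σ K).transpose * S.transpose = 1 := by
      rw [← Matrix.transpose_mul, hST, Matrix.transpose_one]
    have hE : E.transpose = E := Matrix.diagonal_transpose _
    calc (S * E * (T : Matrix σ σ K)).transpose * H
        = (T : Matrix σ σ K).transpose * (E * (S.transpose * H * S)) * T := by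
          simp only [Matrix.transpose_mul, hE, Matrix.mul_assoc, hST, Matrix.mul_one]
      _ = ((T : Matrix σ σ K).transpose * S.transpose) * (H * (S * E * T)) := by
          rw [hG]; simp only [Matrix.mul_assoc]
      _ = H * (S * E * T) := by rw [hTS', Matrix.one_mul]

theorem hessianCoeff_apply [DecidableEq σ] (f : MvPolynomial σ K) (m : σ →₀ ℕ) (p q : σ) :
    hessianCoeff f m p q =
      f.coeff (m + Finsupp.single p 1 + Finsupp.single q 1) *
        ((m + Finsupp.single p 1 : σ →₀ ℕ) q + 1 : ℕ) * (m p + 1 : ℕ) := by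
  simp [hessianCoeff, coeff_pderiv]

end MvPolynomial

/-! ### Monomials of the generic determinant -/

/-- The exponent of the monomial of the generic determinant indexed by the permutation `τ`. -/
noncomputable def permExponent {n : ℕ} (τ : Equiv.Perm (Fin n)) : Fin n × Fin n →₀ ℕ :=
  ∑ r, Finsupp.single (τ r, r) 1

/-- Hence no two terms of the expansion cancel or merge. -/
theorem permExponent_injective {n : ℕ} :
    Function.Injective (permExponent : Equiv.Perm (Fin n) → _) := by
  intro τ ρ h
  ext1 r
  by_contra hr
  have h1 := DFunLike.congr_fun h (τ r, r)
  simp only [permExponent, Finsupp.finsetSum_apply, Finsupp.single_apply, Prod.mk.injEq] at h1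
  rw [Finset.sum_eq_single r (by simp +contextual) (by simp),
    Finset.sum_eq_zero fun x _ => if_neg (by rintro ⟨h2, rfl⟩; exact hr h2.symm)] at h1
  simp at h1

theorem genericDet_eq_sum_monomial (K : Type*) [Field K] (n : ℕ) :
    genericDet K n = ∑ τ : Equiv.Perm (Fin n), monomial (permExponent τ) ((τ.sign : ℤ) : K) := by
  rw [genericDet, Matrix.det_apply']
  refine Finset.sum_congr rfl fun τ _ => ?_
  rw [permExponent, ← mul_one ((τ.sign : ℤ) : K), ← C_mul_monomial, monomial_sum_one]
  simp [X]

theorem coeff_permExponent_genericDet {K : Type*} [Field K] {n : ℕ} (τ : Equiv.Perm (Fin n)) :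
    (genericDet K n).coeff (permExponent τ) = ((τ.sign : ℤ) : K) := by
  simp [genericDet_eq_sum_monomial, coeff_sum, coeff_monomial, permExponent_injective.eq_iff]

theorem exists_permExponent_of_coeff_genericDet_ne_zero {K : Type*} [Field K] {n : ℕ}
    {m : Fin n × Fin n →₀ ℕ} (h : (genericDet K n).coeff m ≠ 0) : ∃ τ, permExponent τ = m := by
  by_contra! hm
  exact h (by simp [genericDet_eq_sum_monomial, coeff_sum, coeff_monomial, hm])

theorem isHomogeneous_genericDet (K : Type*) [Field K] (n : ℕ) :
    (genericDet K n).IsHomogeneous n := by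
  rw [genericDet_eq_sum_monomial]
  refine IsHomogeneous.sum _ _ _ fun τ _ => isHomogeneous_monomial _ ?_
  simp [permExponent]

theorem genericDet_ne_zero (K : Type*) [Field K] (n : ℕ) : genericDet K n ≠ 0 := fun h => by
  simpa [h] using coeff_permExponent_genericDet (K := K) (1 : Equiv.Perm (Fin n))

/-- All terms have the same row multidegree. With its column analogue, this locates the two
variables that complete a monomial to a term of the determinant. -/
theorem mapDomain_fst_permExponent {n : ℕ} (τ : Equiv.Perm (Fin n)) :
    (permExponent τ).mapDomain Prod.fst = ∑ r, Finsupp.single r 1 := by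
  simp only [permExponent, Finsupp.mapDomain_finsetSum, Finsupp.mapDomain_single]
  exact Equiv.sum_comp τ fun r => Finsupp.single r 1

theorem mapDomain_snd_permExponent {n : ℕ} (τ : Equiv.Perm (Fin n)) :
    (permExponent τ).mapDomain Prod.snd = ∑ r, Finsupp.single r 1 := by
  simp only [permExponent, Finsupp.mapDomain_finsetSum, Finsupp.mapDomain_single]

/-- Positions `(i, j)` and `(k, l)` in different rows and columns extend to a permutation. -/
theorem exists_permExponent_eq {n : ℕ} {i j k l : Fin n} (hik : i ≠ k) (hjl : j ≠ l) :
    ∃ (τ : Equiv.Perm (Fin n)) (m : Fin n × Fin n →₀ ℕ), m (i, j) = 0 ∧ m (k, l) = 0 ∧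
      permExponent τ = m + Finsupp.single (i, j) 1 + Finsupp.single (k, l) 1 := by
  -- The first swap sends `j` to `i`; the second moves the image of `l` to `k` without disturbing
  -- `i`.
  let τ := Equiv.swap (Equiv.swap j i l) k * Equiv.swap j i
  have hj : τ j = i := by
    have : i ≠ Equiv.swap j i l := fun h => hjl (by simpa using congrArg (Equiv.swap j i) h)
    simp [τ, Equiv.swap_apply_of_ne_of_ne this hik]
  have hl : τ l = k := by simp [τ]
  refine ⟨τ, ∑ r ∈ (Finset.univ.erase j).erase l, Finsupp.single (τ r, r) 1, ?_, ?_, ?_⟩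
  · rw [Finsupp.finsetSum_apply]
    exact Finset.sum_eq_zero fun r hr => Finsupp.single_eq_of_ne (by simp at hr ⊢; tauto)
  · rw [Finsupp.finsetSum_apply]
    exact Finset.sum_eq_zero fun r hr => Finsupp.single_eq_of_ne (by simp at hr ⊢; tauto)
  · rw [permExponent, ← Finset.sum_erase_add _ _ (Finset.mem_univ j), hj,
      ← Finset.sum_erase_add _ _ (Finset.mem_erase.2 ⟨hjl.symm, Finset.mem_univ l⟩), hl]
    abel

/-- Two positions in different rows and columns are paired by a coefficient matrix of the second
derivatives of the generic determinant which vanishes outside the minor that they span. -/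
theorem exists_hessianCoeff_genericDet (K : Type*) [Field K] {n : ℕ} {i j k l : Fin n}
    (hik : i ≠ k) (hjl : j ≠ l) :
    ∃ m, hessianCoeff (genericDet K n) m (i, j) (k, l) ≠ 0 ∧
      ∀ p q, hessianCoeff (genericDet K n) m p q ≠ 0 →
        (p.1 = i ∧ q.1 = k ∨ p.1 = k ∧ q.1 = i) ∧ (p.2 = j ∧ q.2 = l ∨ p.2 = l ∧ q.2 = j) := by
  obtain ⟨τ, m, h1, h2, hm⟩ := exists_permExponent_eq hik hjl
  refine ⟨m, ?_, fun p q hpq => ?_⟩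
  · rw [hessianCoeff_apply, ← hm, coeff_permExponent_genericDet]
    -- Both exponent factors are 1, so the entry is a sign, nonzero in every characteristic.
    have : (m + Finsupp.single (i, j) 1 : Fin n × Fin n →₀ ℕ) (k, l) = 0 := by simp [h2, hik]
    rw [this, h1]
    rcases Int.units_eq_one_or τ.sign with h | h <;> simp [h]
  · rw [hessianCoeff_apply] at hpq
    obtain ⟨ρ, hρ⟩ := exists_permExponent_of_coeff_genericDet_ne_zero
      (left_ne_zero_of_mul (left_ne_zero_of_mul hpq))
    constructor
    -- Cancelling the rows of `m` leaves the equality of multisets `{p.1, q.1} = {i, k}`.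
    · have h := (mapDomain_fst_permExponent ρ).trans (mapDomain_fst_permExponent τ).symm
      rw [hρ, hm] at h
      simp only [Finsupp.mapDomain_add, Finsupp.mapDomain_single, add_assoc, add_right_inj] at h
      simpa using (Finsupp.single_add_single_eq_single_add_single one_ne_zero one_ne_zero).1 h
    · have h := (mapDomain_snd_permExponent ρ).trans (mapDomain_snd_permExponent τ).symm
      rw [hρ, hm] at h
      simp only [Finsupp.mapDomain_add, Finsupp.mapDomain_single, add_assoc, add_right_inj] at h
      simpa using (Finsupp.single_add_single_eq_single_add_single one_ne_zero one_ne_zero).1 h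

/-- For `n > 2`, an operator that is self-adjoint for all second derivatives of the generic
determinant is scalar. -/
theorem eq_scalar_of_selfAdjoint_hessianCoeff_genericDet {K : Type*} [Field K] {n : ℕ}
    (hn : 2 < n) {P : Matrix (Fin n × Fin n) (Fin n × Fin n) K}
    (hP : ∀ m, P.transpose * hessianCoeff (genericDet K n) m = hessianCoeff (genericDet K n) m * P) :
    ∃ c : K, P = Matrix.scalar _ c := by
  -- The only use of `n > 2`.
  have hthird (a b : Fin n) : ∃ c, c ≠ a ∧ c ≠ b := by
    obtain ⟨c, hc⟩ := Finset.exists_mem_notMem_of_card_lt_card (s := {a, b}) (t := Finset.univ)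
      (lt_of_le_of_lt Finset.card_le_two (by simpa using hn))
    exact ⟨c, by simpa using hc.2⟩
  -- Row `(i, j)` of this matrix has its only nonzero entry in column `(k, l)`, so the product with
  -- `P` reduces to one term.
  have hright {i j k l : Fin n} (hik : i ≠ k) (hjl : j ≠ l) (q : Fin n × Fin n) :
      ∃ m, hessianCoeff (genericDet K n) m (i, j) (k, l) ≠ 0 ∧
        (∀ p q, hessianCoeff (genericDet K n) m p q ≠ 0 →
        (p.1 = i ∧ q.1 = k ∨ p.1 = k ∧ q.1 = i) ∧ (p.2 = j ∧ q.2 = l ∨ p.2 = l ∧ q.2 = j)) ∧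
        ∑ r, P r (i, j) * hessianCoeff (genericDet K n) m r q =
          hessianCoeff (genericDet K n) m (i, j) (k, l) * P (k, l) q := by
    obtain ⟨m, h1, h2⟩ := exists_hessianCoeff_genericDet K hik hjl
    refine ⟨m, h1, h2, ?_⟩
    have h := congrFun (congrFun (hP m) (i, j)) q
    simp only [Matrix.mul_apply, Matrix.transpose_apply] at h
    rw [h]
    refine Finset.sum_eq_single (k, l) (fun r _ hr => ?_) (by simp)
    by_contra hne
    have := h2 _ _ (left_ne_zero_of_mul hne)
    refine hr (Prod.ext ?_ ?_) <;> simp_all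
  have hoff (p q : Fin n × Fin n) (hpq : p ≠ q) : P p q = 0 := by
    obtain ⟨k, l⟩ := p
    -- With `i ≠ q.1` and `j ≠ q.2`, column `q` could be nonzero only for `q = (k, l) = p`; hence it
    -- vanishes.
    obtain ⟨i, hi, hiq⟩ := hthird k q.1
    obtain ⟨j, hj, hjq⟩ := hthird l q.2
    obtain ⟨m, h1, h2, h3⟩ := hright hi hj q
    rw [Finset.sum_eq_zero] at h3
    · exact (mul_eq_zero.1 h3.symm).resolve_left h1
    · intro r _
      by_contra hne
      obtain ⟨h4, h5⟩ := h2 _ _ (right_ne_zero_of_mul hne)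
      refine hpq (Prod.ext ?_ ?_)
      · rcases h4 with h | h
        · exact h.2.symm
        · exact absurd h.2.symm hiq
      · rcases h5 with h | h
        · exact h.2.symm
        · exact absurd h.2.symm hjq
  have hdiag {i j k l : Fin n} (hik : i ≠ k) (hjl : j ≠ l) : P (i, j) (i, j) = P (k, l) (k, l) := by
    obtain ⟨m, h1, h2, h3⟩ := hright hik hjl (k, l)
    rw [Finset.sum_eq_single (i, j) (fun r _ hr => by rw [hoff _ _ hr, zero_mul]) (by simp),
      mul_comm] at h3
    exact mul_left_cancel₀ h1 h3
  let o : Fin n := ⟨0, by omega⟩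
  refine ⟨P (o, o) (o, o), ?_⟩
  ext ⟨i, j⟩ q
  rw [Matrix.scalar_apply]
  by_cases hq : (i, j) = q
  · subst hq
    -- `(i, j)` and `(o, o)` may share a row or column, so they are compared through a position `(k,
    -- l)` that avoids the rows and columns of both.
    obtain ⟨k, hk, hk'⟩ := hthird i o
    obtain ⟨l, hl, hl'⟩ := hthird j o
    rw [Matrix.diagonal_apply_eq, hdiag hk.symm hl.symm, hdiag hk' hl']
  · rw [hoff _ _ hq, Matrix.diagonal_apply_ne _ hq]

theorem mainTheorem5 {K : Type*} [Field K] (n : ℕ) (hn : 2 < n) :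
    (genericDet K n).IsHomogeneous n ∧ ¬ IsDirectSumForm (genericDet K n) := by
  refine ⟨isHomogeneous_genericDet K n, fun h => ?_⟩
  obtain ⟨P, hP, hPm⟩ := exists_nonscalar_selfAdjoint_of_isDirectSumForm (by omega)
    (isHomogeneous_genericDet K n) (genericDet_ne_zero K n) h
  obtain ⟨c, hc⟩ := eq_scalar_of_selfAdjoint_hessianCoeff_genericDet hn hPm
  exact hP c hc
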